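/- **Theorem 3.2.** Let $K$ be a simplicial complex on the set $[m]=\{1,\dots,m\}$, i.e. a family of subsets of $[m]$ (the simplices of $K$) that contains $\varnothing$ and is closed under passing to subsets (not every element of $[m]$ needs to be a vertex of $K$). Let $\operatorname{mdim}K$ be the minimal dimension $|\omega|-1$ of a simplex $\omega$ of $K$ that is maximal by inclusion. Let $$\mathbb{R}\mathcal{Z}_K=(I^1,S^0)^K=\bigcup_{\omega\in K}\{(x_1,\dots,x_m)\in[-1,1]^m : x_i\in\{-1,1\}\text{ for } i\notin\omega\}$$ be the real moment-angle complex of $K$, a subspace of $\mathbb{R}^m$. If $n\ge 0$ is an integer with $\operatorname{mdim}K=n-1$, then $$\operatorname{hrk}(\mathbb{R}\mathcal{Z}_K,\mathbb{Q}):=\sum_{i\ge 0}\dim_{\mathbb{Q}}H^i(\mathbb{R}\mathcal{Z}_K;\mathbb{Q})\ \ge\ 2^{m-n},$$ where $H^i(-;\mathbb{Q})$ is singular cohomology. -/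

import Mathlib

open CategoryTheory

/-- `IsSimplex K ω`: the set of vertices `ω` is a simplex of `K`. Mathlib lists only the nonempty
simplices of a complex; as usual for `K`-powers, the empty set is a simplex too. Points of `V` need
not be vertices of `K`. -/
def PreAbstractSimplicialComplex.IsSimplex {V : Type*} (K : PreAbstractSimplicialComplex V)
    (ω : Finset V) : Prop :=
  ω = ∅ ∨ ω ∈ K

/-- The set of the dimensions `|ω| - 1` of the simplices `ω` of `K` that are maximal by inclusion
(the empty simplex has dimension `-1`). -/
def PreAbstractSimplicialComplex.maximalSimplexDims {V : Type*}
    (K : PreAbstractSimplicialComplex V) : Set ℤ :=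
  {d | ∃ ω : Finset V, Maximal K.IsSimplex ω ∧ d = (ω.card : ℤ) - 1}

/-- `mdim K`, the minimal dimension of the maximal by inclusion simplices of `K`. -/
noncomputable def PreAbstractSimplicialComplex.mdim {V : Type*}
    (K : PreAbstractSimplicialComplex V) : ℤ :=
  sInf K.maximalSimplexDims

/-- On a finite vertex set the minimum in the definition of `mdim` is attained. -/
theorem PreAbstractSimplicialComplex.isLeast_mdim {V : Type*} [Finite V]
    (K : PreAbstractSimplicialComplex V) : IsLeast K.maximalSimplexDims K.mdim := by
  have hne : K.maximalSimplexDims.Nonempty := by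
    obtain ⟨ω, -, hω⟩ :=
      Set.Finite.exists_le_maximal (s := {ω | K.IsSimplex ω}) (Set.toFinite _) (Or.inl rfl)
    exact ⟨_, ω, hω, rfl⟩
  have hbdd : BddBelow K.maximalSimplexDims := by
    refine ⟨-1, ?_⟩
    rintro d ⟨ω, -, rfl⟩
    omega
  exact ⟨Int.csInf_mem hne hbdd, fun d hd => csInf_le hbdd hd⟩

/-- The `K`-power `(X, A)^K` of a pair `A ⊆ X` of subspaces of a space `α`: the union over the
simplices `ω` of `K` of `(X, A)^ω = {x ∈ X^V | x i ∈ A for i ∉ ω}`. -/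
def kPower {V : Type*} {α : Type*} (X A : Set α) (K : PreAbstractSimplicialComplex V) :
    Set (V → α) :=
  ⋃ ω ∈ {ω : Finset V | K.IsSimplex ω}, {x | (∀ i, x i ∈ X) ∧ ∀ i, i ∉ ω → x i ∈ A}

/-- The real moment-angle complex `(I¹, S⁰)^K`, a subspace of the cube `[-1, 1]^V`. -/
def realMomentAngleComplex {V : Type*} (K : PreAbstractSimplicialComplex V) : Set (V → ℝ) :=
  kPower (Set.Icc (-1) 1) {-1, 1} K

/-- The rational singular cochain complex of a space `X`: the complex of `ℚ`-linear maps from the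
singular chain complex of `X` with coefficients in `ℚ` to `ℚ`. -/
noncomputable def rationalSingularCochainComplex (X : Type) [TopologicalSpace X] :
    CochainComplex (ModuleCat.{0} ℚ) ℕ :=
  (((AlgebraicTopology.singularChainComplexFunctor (ModuleCat.{0} ℚ)).obj
    (ModuleCat.of ℚ ℚ)).obj (TopCat.of X)).linearYonedaObj ℚ (ModuleCat.of ℚ ℚ)

/-- The rational singular cohomology `Hⁱ(X; ℚ)`. -/
noncomputable def rationalCohomology (X : Type) [TopologicalSpace X] (i : ℕ) : ModuleCat.{0} ℚ :=
  (rationalSingularCochainComplex X).homology i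

/-- The total rational cohomology rank `hrk(X, ℚ) = ∑ᵢ dim Hⁱ(X; ℚ)`, as a cardinal (so that no
finiteness has to be presupposed). -/
noncomputable def hrk (X : Type) [TopologicalSpace X] : Cardinal.{0} :=
  Cardinal.sum fun i : ℕ => Module.rank ℚ (rationalCohomology X i)

/-! Choose a maximal simplex `ω` with `n` vertices and cut the real moment-angle complex by the
hyperplanes `x v = 0`, one for each `v ∈ ω`. Maximality of `ω` leaves only the points with
coordinates `±1` outside `ω`, which are `2 ^ (m - n)` isolated points, so the total homology rank of
the final slice is at least that number. It remains to see that no cut raises the total rank.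

For one cut of `X`, let `Z` be the slice `x v = 0` and `Y` the side `x v = 1`. The side `x v = -1`
is a copy of `Y`, and a cylinder over `Z ⊆ Y` joins the two sides. In the Mayer–Vietoris sequence of
`U = {x v > -1}` and `V = {x v < 1}`, both maps out of `H_n(Z)` factor through the same `f : H_n(Z)
→ H_n(Y)`, so every class in `ker f` comes from `H_{n+1}(X)`. It survives modulo the image of
`H_{n+1}(Y)`, while `H_n(Y)` embeds in `H_n(X)` because `Y` is a retract of `X`. Hence `H_*(X)` has
room for both `ker f` and `im f`, that is, for the total rank of `Z` (`totalRank_le_of_openCover`,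
`totalRank_slice_le`).

The Mayer–Vietoris input is proved by barycentric subdivision on explicit singular chains
(`exists_bd_eq_sd_pow_bd`). Homotopy invariance is transported from Mathlib's singular complex.
Cohomology enters only at the end, through an embedding of the dual of homology
(`rank_homology_le`). Ranks are cardinals, so no finiteness is needed. -/

/-! ### Chains of vertex tuples -/

/-- The `ℚ`-vector space freely generated by the `k`-tuples of points of `P`. -/
abbrev TupleChain (P : Type*) (k : ℕ) : Type _ := (Fin k → P) →₀ ℚ

namespace TupleChain

variable {P Q : Type*}

/-- The boundary of a chain of tuples; `()` is the boundary of a one-point tuple. -/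
noncomputable def bd (P : Type*) (k : ℕ) : TupleChain P (k + 1) →ₗ[ℚ] TupleChain P k :=
  Finsupp.lift _ ℚ _ fun v => ∑ i : Fin (k + 1), (-1 : ℚ) ^ (i : ℕ) • Finsupp.single (v ∘ i.succAbove) 1

/-- The cone with apex `a` over a chain of tuples. -/
noncomputable def cone (k : ℕ) (a : P) : TupleChain P k →ₗ[ℚ] TupleChain P (k + 1) :=
  Finsupp.lmapDomain ℚ ℚ fun v => (Fin.cons a v : Fin (k + 1) → P)

/-- The pushforward of a chain of tuples. -/
noncomputable def map (k : ℕ) (φ : P → Q) : TupleChain P k →ₗ[ℚ] TupleChain Q k :=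
  Finsupp.lmapDomain ℚ ℚ (φ ∘ ·)

theorem bd_single (k : ℕ) (v : Fin (k + 1) → P) : bd P k (Finsupp.single v 1) =
    ∑ i : Fin (k + 1), (-1 : ℚ) ^ (i : ℕ) • Finsupp.single (v ∘ i.succAbove) 1 := by
  simp [bd]

theorem cone_single (k : ℕ) (a : P) (v : Fin k → P) :
    cone k a (Finsupp.single v 1) = Finsupp.single (Fin.cons a v) 1 := by
  simp [cone]

theorem map_single (k : ℕ) (φ : P → Q) (v : Fin k → P) :
    map k φ (Finsupp.single v 1) = Finsupp.single (φ ∘ v) 1 := by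
  simp [map]

theorem hom_ext {k : ℕ} {M : Type*} [AddCommGroup M] [Module ℚ M] {f g : TupleChain P k →ₗ[ℚ] M}
    (h : ∀ v, f (Finsupp.single v 1) = g (Finsupp.single v 1)) : f = g := by
  ext v
  simpa using h v

theorem bd_cone_zero (a : P) (c : TupleChain P 0) : bd P 0 (cone 0 a c) = c := by
  refine LinearMap.congr_fun (f := bd P 0 ∘ₗ cone 0 a) (g := LinearMap.id)
    (hom_ext fun v => ?_) c
  simp only [LinearMap.comp_apply, cone_single, bd_single, LinearMap.id_apply]
  simp [Subsingleton.elim _ v]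

/-- Deleting the apex returns `c`; deleting any other vertex gives a cone over a face, with its sign
shifted by one. All later chain identities rest on this formula. -/
theorem bd_cone (k : ℕ) (a : P) (c : TupleChain P (k + 1)) :
    bd P (k + 1) (cone (k + 1) a c) = c - cone k a (bd P k c) := by
  refine LinearMap.congr_fun (f := bd P (k + 1) ∘ₗ cone (k + 1) a)
    (g := LinearMap.id - cone k a ∘ₗ bd P k)
    (hom_ext fun v => ?_) c
  simp only [LinearMap.comp_apply, cone_single, bd_single, LinearMap.id_apply, LinearMap.sub_apply,
    map_sum, map_smul]
  rw [Fin.sum_univ_succ, sub_eq_add_neg, ← Finset.sum_neg_distrib]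
  congr 1
  · simp [Function.comp_def]
  · refine Finset.sum_congr rfl fun i _ => ?_
    have : (Fin.cons a v : Fin (k + 2) → P) ∘ i.succ.succAbove =
        Fin.cons a (v ∘ i.succAbove) := by
      funext j
      refine Fin.cases ?_ (fun j => ?_) j <;> simp
    rw [this, Fin.val_succ, pow_succ]
    simp

theorem single_eq_cone (k : ℕ) (v : Fin (k + 1) → P) :
    (Finsupp.single v 1 : TupleChain P (k + 1)) =
      cone k (v 0) (Finsupp.single (Fin.tail v) 1) := by
  rw [cone_single, Fin.cons_self_tail]

/-- A nonempty tuple is the cone from its first vertex over the rest, so the cone formula reduces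
the claim to shorter tuples. -/
theorem bd_bd (k : ℕ) (c : TupleChain P (k + 2)) : bd P k (bd P (k + 1) c) = 0 := by
  induction k with
  | zero =>
    refine LinearMap.congr_fun (f := bd P 0 ∘ₗ bd P 1) (g := 0)
      (hom_ext fun v => ?_) c
    rw [LinearMap.comp_apply, single_eq_cone, bd_cone, map_sub, bd_cone_zero, sub_self]
    simp
  | succ k ih =>
    refine LinearMap.congr_fun (f := bd P (k + 1) ∘ₗ bd P (k + 2)) (g := 0)
      (hom_ext fun v => ?_) c
    rw [LinearMap.comp_apply, single_eq_cone, bd_cone, map_sub, bd_cone, ih]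
    simp

theorem map_bd (k : ℕ) (φ : P → Q) (c : TupleChain P (k + 1)) :
    map k φ (bd P k c) = bd Q k (map (k + 1) φ c) := by
  refine LinearMap.congr_fun (f := map k φ ∘ₗ bd P k) (g := bd Q k ∘ₗ map (k + 1) φ)
    (hom_ext fun v => ?_) c
  simp only [LinearMap.comp_apply, bd_single, map_sum, map_smul, map_single, Function.comp_assoc]

theorem map_cone (k : ℕ) (φ : P → Q) (a : P) (c : TupleChain P k) :
    map (k + 1) φ (cone k a c) = cone k (φ a) (map k φ c) := by
  refine LinearMap.congr_fun (f := map (k + 1) φ ∘ₗ cone k a) (g := cone k (φ a) ∘ₗ map k φ)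
    (hom_ext fun v => ?_) c
  simp only [LinearMap.comp_apply, cone_single, map_single]
  congr 1
  funext j
  refine Fin.cases ?_ (fun j => ?_) j <;> simp

/-- The barycentric subdivision of a chain of tuples, where `β` returns the barycenter of a tuple. -/
noncomputable def sd (β : ∀ k, (Fin (k + 1) → P) → P) : ∀ k, TupleChain P k →ₗ[ℚ] TupleChain P k
  | 0 => LinearMap.id
  | k + 1 => Finsupp.lift _ ℚ _ fun v => cone k (β k v) (sd β k (bd P k (Finsupp.single v 1)))

/-- The chain homotopy from the barycentric subdivision to the identity. -/
noncomputable def sdHomotopy (β : ∀ k, (Fin (k + 1) → P) → P) :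
    ∀ k, TupleChain P k →ₗ[ℚ] TupleChain P (k + 1)
  | 0 => 0
  | k + 1 => Finsupp.lift _ ℚ _ fun v => cone (k + 1) (β k v) (Finsupp.single v 1 -
      sd β (k + 1) (Finsupp.single v 1) - sdHomotopy β k (bd P k (Finsupp.single v 1)))

variable (β : ∀ k, (Fin (k + 1) → P) → P)

theorem sd_single (k : ℕ) (v : Fin (k + 1) → P) : sd β (k + 1) (Finsupp.single v 1) =
    cone k (β k v) (sd β k (bd P k (Finsupp.single v 1))) := by
  simp [sd]

theorem sdHomotopy_single (k : ℕ) (v : Fin (k + 1) → P) :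
    sdHomotopy β (k + 1) (Finsupp.single v 1) = cone (k + 1) (β k v) (Finsupp.single v 1 -
      sd β (k + 1) (Finsupp.single v 1) - sdHomotopy β k (bd P k (Finsupp.single v 1))) := by
  simp [sdHomotopy]

theorem bd_sd (k : ℕ) (c : TupleChain P (k + 1)) :
    bd P k (sd β (k + 1) c) = sd β k (bd P k c) := by
  induction k with
  | zero =>
    refine LinearMap.congr_fun (f := bd P 0 ∘ₗ sd β 1) (g := sd β 0 ∘ₗ bd P 0)
      (hom_ext fun v => ?_) c
    rw [LinearMap.comp_apply, sd_single, bd_cone_zero, LinearMap.comp_apply]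
  | succ k ih =>
    refine LinearMap.congr_fun (f := bd P (k + 1) ∘ₗ sd β (k + 2)) (g := sd β (k + 1) ∘ₗ bd P (k + 1))
      (hom_ext fun v => ?_) c
    rw [LinearMap.comp_apply, sd_single, bd_cone, ih, bd_bd, LinearMap.comp_apply]
    simp

/-- The chain coned off in the definition of `sdHomotopy` is a cycle by induction, so the correction
term of the cone formula vanishes. -/
theorem bd_sdHomotopy (k : ℕ) (c : TupleChain P (k + 1)) :
    bd P (k + 1) (sdHomotopy β (k + 1) c) = c - sd β (k + 1) c - sdHomotopy β k (bd P k c) := by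
  induction k with
  | zero =>
    refine LinearMap.congr_fun (f := bd P 1 ∘ₗ sdHomotopy β 1)
      (g := LinearMap.id - sd β 1 - sdHomotopy β 0 ∘ₗ bd P 0)
      (hom_ext fun v => ?_) c
    rw [LinearMap.comp_apply, sdHomotopy_single, bd_cone]
    simp only [map_sub, bd_sd]
    simp [sd, sdHomotopy]
  | succ k ih =>
    refine LinearMap.congr_fun (f := bd P (k + 2) ∘ₗ sdHomotopy β (k + 2))
      (g := LinearMap.id - sd β (k + 2) - sdHomotopy β (k + 1) ∘ₗ bd P (k + 1))
      (hom_ext fun v => ?_) c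
    rw [LinearMap.comp_apply, sdHomotopy_single, bd_cone]
    simp only [map_sub, bd_sd, ih, bd_bd]
    simp

section Naturality

variable {β} {γ : ∀ k, (Fin (k + 1) → Q) → Q} {φ : P → Q}

/-- A map that commutes with the choice of barycenters commutes with a construction made only of
cones and boundaries. Affine maps qualify by `TopSimplex.comb_center`. -/
theorem map_sd (hφ : ∀ k v, φ (β k v) = γ k (φ ∘ v)) (k : ℕ) (c : TupleChain P k) :
    map k φ (sd β k c) = sd γ k (map k φ c) := by
  induction k with
  | zero => rfl
  | succ k ih =>
    refine LinearMap.congr_fun (f := map (k + 1) φ ∘ₗ sd β (k + 1))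
      (g := sd γ (k + 1) ∘ₗ map (k + 1) φ)
      (hom_ext fun v => ?_) c
    rw [LinearMap.comp_apply, LinearMap.comp_apply, sd_single, map_cone, ih, map_bd, hφ, map_single,
      sd_single]

theorem map_sdHomotopy (hφ : ∀ k v, φ (β k v) = γ k (φ ∘ v)) (k : ℕ) (c : TupleChain P k) :
    map (k + 1) φ (sdHomotopy β k c) = sdHomotopy γ k (map k φ c) := by
  induction k with
  | zero => simp [sdHomotopy]
  | succ k ih =>
    refine LinearMap.congr_fun (f := map (k + 2) φ ∘ₗ sdHomotopy β (k + 1))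
      (g := sdHomotopy γ (k + 1) ∘ₗ map (k + 1) φ)
      (hom_ext fun v => ?_) c
    simp only [LinearMap.comp_apply, sdHomotopy_single, map_cone, map_sub, ih, map_bd, hφ,
      map_sd hφ, map_single]

end Naturality

/-- The chains of tuples that satisfy a predicate. -/
abbrev of (k : ℕ) (p : (Fin k → P) → Prop) : Submodule ℚ (TupleChain P k) :=
  Finsupp.supported ℚ ℚ {v | p v}

theorem single_mem_of {k : ℕ} {p : (Fin k → P) → Prop} {v : Fin k → P} (h : p v) :
    Finsupp.single v 1 ∈ of k p :=
  Finsupp.single_mem_supported ℚ _ h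

theorem map_mem_of_forall {k : ℕ} {M : Type*} [AddCommGroup M] [Module ℚ M] {p : (Fin k → P) → Prop}
    {N : Submodule ℚ M} {f : TupleChain P k →ₗ[ℚ] M}
    (h : ∀ v, p v → f (Finsupp.single v 1) ∈ N) {c : TupleChain P k} (hc : c ∈ of k p) :
    f c ∈ N := by
  have : of k p ≤ N.comap f := by
    rw [of, Finsupp.supported_eq_span_single, Submodule.span_le]
    rintro _ ⟨v, hv, rfl⟩
    exact h v hv
  exact this hc

end TupleChain

/-! ### Affine maps between standard simplices -/

/-- The topological simplex with `k` vertices. -/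
abbrev TopSimplex (k : ℕ) : Type := stdSimplex ℝ (Fin k)

namespace TopSimplex

variable {i j k l : ℕ}

/-- The affine map of simplices with prescribed images of the vertices. -/
noncomputable def comb (v : Fin j → TopSimplex k) : C(TopSimplex j, TopSimplex k) where
  toFun s := ⟨∑ i, s i • (v i : Fin k → ℝ), (convex_stdSimplex ℝ _).sum_mem
    (fun i _ => s.2.1 i) s.2.2 (fun i _ => (v i).2)⟩
  continuous_toFun := by
    refine Continuous.subtype_mk (continuous_finsetSum _ fun i _ => ?_) _
    exact ((continuous_apply i).comp continuous_subtype_val).smul continuous_const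

theorem comb_apply (v : Fin j → TopSimplex k) (s : TopSimplex j) (x : Fin k) :
    comb v s x = ∑ i, s i * v i x := by
  change (∑ i, s i • (v i : Fin k → ℝ)) x = _
  simp only [Finset.sum_apply, Pi.smul_apply, smul_eq_mul]

/-- The tuple of the vertices of a simplex. -/
noncomputable def vertices (k : ℕ) : Fin k → TopSimplex k := stdSimplex.vertex

@[simp]
theorem comb_vertices : comb (vertices k) = ContinuousMap.id _ := by
  ext s x
  refine (comb_apply _ _ _).trans ?_
  simp [vertices, Pi.single_apply]

@[simp]
theorem comb_comp_vertices (v : Fin j → TopSimplex k) : comb v ∘ vertices j = v := by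
  funext i
  ext x
  refine (comb_apply _ _ _).trans ?_
  simp [vertices, Pi.single_apply]

theorem comb_comp_comb (w : Fin k → TopSimplex l) (v : Fin j → TopSimplex k) :
    (comb w).comp (comb v) = comb (comb w ∘ v) := by
  ext s x
  refine (comb_apply _ _ _).trans (Eq.trans ?_ (comb_apply _ _ _).symm)
  simp only [comb_apply, Function.comp_apply, Finset.sum_mul, Finset.mul_sum, mul_assoc]
  exact Finset.sum_comm

/-- The map of simplices induced by a map of their vertices. -/
noncomputable def face (f : Fin j → Fin k) : C(TopSimplex j, TopSimplex k) :=
  ⟨stdSimplex.map f, stdSimplex.continuous_map f⟩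

theorem face_eq_comb (f : Fin j → Fin k) : face f = comb (vertices k ∘ f) := by
  ext s x
  refine Eq.trans ?_ (comb_apply _ _ _).symm
  change FunOnFinite.linearMap ℝ ℝ f s x = _
  rw [FunOnFinite.linearMap_apply_apply, Finset.sum_filter]
  simp [vertices, Pi.single_apply, eq_comm]

theorem comb_comp_face (v : Fin k → TopSimplex l) (f : Fin j → Fin k) :
    (comb v).comp (face f) = comb (v ∘ f) := by
  rw [face_eq_comb, comb_comp_comb, ← Function.comp_assoc, comb_comp_vertices]

/-- The barycenter of a tuple of points of a simplex. -/
noncomputable def center (l : ℕ) (k : ℕ) (v : Fin (k + 1) → TopSimplex l) : TopSimplex l :=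
  comb v stdSimplex.barycenter

theorem comb_center (w : Fin j → TopSimplex l) (k : ℕ) (v : Fin (k + 1) → TopSimplex j) :
    comb w (center j k v) = center l k (comb w ∘ v) := by
  rw [center, center, ← comb_comp_comb]
  rfl

end TopSimplex

/-! ### Singular chains -/

/-- The rational singular chains of `X`, indexed by the number of vertices of the simplices; there
is a unique simplex without vertices. -/
abbrev SingChain (X : Type*) [TopologicalSpace X] (k : ℕ) : Type _ := C(TopSimplex k, X) →₀ ℚ

namespace SingChain

open TopSimplex

variable {X Y Z : Type*} [TopologicalSpace X] [TopologicalSpace Y] [TopologicalSpace Z]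

/-- The boundary of singular chains. -/
noncomputable def bd (X : Type*) [TopologicalSpace X] (k : ℕ) :
    SingChain X (k + 1) →ₗ[ℚ] SingChain X k :=
  Finsupp.lift _ ℚ _ fun σ =>
    ∑ i : Fin (k + 1), (-1 : ℚ) ^ (i : ℕ) • Finsupp.single (σ.comp (face i.succAbove)) 1

/-- The pushforward of singular chains. -/
noncomputable def map (k : ℕ) (f : C(X, Y)) : SingChain X k →ₗ[ℚ] SingChain Y k :=
  Finsupp.lmapDomain ℚ ℚ f.comp

/-- The singular chain defined by a chain of tuples of points of a simplex. -/
noncomputable def ofTuple (j k : ℕ) : TupleChain (TopSimplex j) k →ₗ[ℚ] SingChain (TopSimplex j) k :=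
  Finsupp.lmapDomain ℚ ℚ comb

theorem bd_single (k : ℕ) (σ : C(TopSimplex (k + 1), X)) : bd X k (Finsupp.single σ 1) =
    ∑ i : Fin (k + 1), (-1 : ℚ) ^ (i : ℕ) • Finsupp.single (σ.comp (face i.succAbove)) 1 := by
  simp [bd]

theorem map_single (k : ℕ) (f : C(X, Y)) (σ : C(TopSimplex k, X)) :
    map k f (Finsupp.single σ 1) = Finsupp.single (f.comp σ) 1 := by
  simp [map]

theorem ofTuple_single (j k : ℕ) (v : Fin k → TopSimplex j) :
    ofTuple j k (Finsupp.single v 1) = Finsupp.single (comb v) 1 := by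
  simp [ofTuple]

theorem hom_ext {k : ℕ} {M : Type*} [AddCommGroup M] [Module ℚ M] {f g : SingChain X k →ₗ[ℚ] M}
    (h : ∀ σ, f (Finsupp.single σ 1) = g (Finsupp.single σ 1)) : f = g := by
  ext σ
  simpa using h σ

theorem map_comp (k : ℕ) (g : C(Y, Z)) (f : C(X, Y)) (c : SingChain X k) :
    map k (g.comp f) c = map k g (map k f c) := by
  refine LinearMap.congr_fun (f := map k (g.comp f)) (g := map k g ∘ₗ map k f)
    (hom_ext fun σ => ?_) c
  simp only [LinearMap.comp_apply, map_single, ContinuousMap.comp_assoc]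

theorem map_id (k : ℕ) (c : SingChain X k) : map k (.id X) c = c := by
  refine LinearMap.congr_fun (f := map k (.id X)) (g := LinearMap.id)
    (hom_ext fun σ => ?_) c
  simp only [map_single, ContinuousMap.id_comp, LinearMap.id_apply]

theorem map_bd (k : ℕ) (f : C(X, Y)) (c : SingChain X (k + 1)) :
    map k f (bd X k c) = bd Y k (map (k + 1) f c) := by
  refine LinearMap.congr_fun (f := map k f ∘ₗ bd X k) (g := bd Y k ∘ₗ map (k + 1) f)
    (hom_ext fun σ => ?_) c
  simp only [LinearMap.comp_apply, bd_single, map_sum, map_smul, map_single,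
    ContinuousMap.comp_assoc]

theorem ofTuple_bd (j k : ℕ) (c : TupleChain (TopSimplex j) (k + 1)) :
    ofTuple j k (TupleChain.bd _ k c) = bd _ k (ofTuple j (k + 1) c) := by
  refine LinearMap.congr_fun (f := ofTuple j k ∘ₗ TupleChain.bd _ k)
    (g := bd _ k ∘ₗ ofTuple j (k + 1)) (TupleChain.hom_ext fun v => ?_) c
  simp only [LinearMap.comp_apply, bd_single, TupleChain.bd_single, map_sum, map_smul,
    ofTuple_single, comb_comp_face]

theorem ofTuple_map (j l k : ℕ) (w : Fin j → TopSimplex l) (c : TupleChain (TopSimplex j) k) :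
    ofTuple l k (TupleChain.map k (comb w) c) = map k (comb w) (ofTuple j k c) := by
  refine LinearMap.congr_fun (f := ofTuple l k ∘ₗ TupleChain.map k (comb w))
    (g := map k (comb w) ∘ₗ ofTuple j k) (TupleChain.hom_ext fun v => ?_) c
  simp only [LinearMap.comp_apply, TupleChain.map_single, map_single, ofTuple_single,
    comb_comp_comb]

/-- The barycentric subdivision of singular chains. -/
noncomputable def sd (X : Type*) [TopologicalSpace X] (k : ℕ) : SingChain X k →ₗ[ℚ] SingChain X k :=
  Finsupp.lift _ ℚ _ fun σ =>
    map k σ (ofTuple k k (TupleChain.sd (center k) k (Finsupp.single (vertices k) 1)))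

/-- The chain homotopy from the barycentric subdivision to the identity. -/
noncomputable def sdHomotopy (X : Type*) [TopologicalSpace X] (k : ℕ) :
    SingChain X k →ₗ[ℚ] SingChain X (k + 1) :=
  Finsupp.lift _ ℚ _ fun σ => map (k + 1) σ
    (ofTuple k (k + 1) (TupleChain.sdHomotopy (center k) k (Finsupp.single (vertices k) 1)))

theorem single_eq_map (k : ℕ) (σ : C(TopSimplex k, X)) : (Finsupp.single σ 1 : SingChain X k) =
    map k σ (ofTuple k k (Finsupp.single (vertices k) 1)) := by
  rw [ofTuple_single, map_single, comb_vertices, ContinuousMap.comp_id]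

theorem bd_map_ofTuple (j k : ℕ) (σ : C(TopSimplex j, X))
    (c : TupleChain (TopSimplex j) (k + 1)) :
    bd X k (map (k + 1) σ (ofTuple j (k + 1) c)) = map k σ (ofTuple j k (TupleChain.bd _ k c)) := by
  rw [← map_bd, ofTuple_bd]

/-- Subdividing an affine simplex directly agrees with transporting the subdivision of the standard
simplex. Since every singular simplex is the image of the identity simplex (`single_eq_map`),
identities for tuples pass to singular chains through this lemma. -/
theorem sd_map_ofTuple (j k : ℕ) (σ : C(TopSimplex j, X)) (c : TupleChain (TopSimplex j) k) :
    sd X k (map k σ (ofTuple j k c)) =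
      map k σ (ofTuple j k (TupleChain.sd (center j) k c)) := by
  refine LinearMap.congr_fun (f := sd X k ∘ₗ map k σ ∘ₗ ofTuple j k)
    (g := map k σ ∘ₗ ofTuple j k ∘ₗ TupleChain.sd (center j) k) (TupleChain.hom_ext fun v => ?_) c
  simp only [LinearMap.comp_apply, ofTuple_single, map_single]
  rw [sd, Finsupp.lift_apply, Finsupp.sum_single_index (by simp), one_smul, map_comp,
    ← ofTuple_map, TupleChain.map_sd (comb_center v), TupleChain.map_single, comb_comp_vertices]

theorem sdHomotopy_map_ofTuple (j k : ℕ) (σ : C(TopSimplex j, X))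
    (c : TupleChain (TopSimplex j) k) :
    sdHomotopy X k (map k σ (ofTuple j k c)) =
      map (k + 1) σ (ofTuple j (k + 1) (TupleChain.sdHomotopy (center j) k c)) := by
  refine LinearMap.congr_fun (f := sdHomotopy X k ∘ₗ map k σ ∘ₗ ofTuple j k)
    (g := map (k + 1) σ ∘ₗ ofTuple j (k + 1) ∘ₗ TupleChain.sdHomotopy (center j) k)
    (TupleChain.hom_ext fun v => ?_) c
  simp only [LinearMap.comp_apply, ofTuple_single, map_single]
  rw [sdHomotopy, Finsupp.lift_apply, Finsupp.sum_single_index (by simp), one_smul, map_comp,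
    ← ofTuple_map, TupleChain.map_sdHomotopy (comb_center v), TupleChain.map_single,
    comb_comp_vertices]

theorem bd_bd (k : ℕ) (c : SingChain X (k + 2)) : bd X k (bd X (k + 1) c) = 0 := by
  refine LinearMap.congr_fun (f := bd X k ∘ₗ bd X (k + 1)) (g := 0) (hom_ext fun σ => ?_) c
  rw [single_eq_map, LinearMap.comp_apply, bd_map_ofTuple, bd_map_ofTuple, TupleChain.bd_bd]
  simp

theorem bd_sd (k : ℕ) (c : SingChain X (k + 1)) :
    bd X k (sd X (k + 1) c) = sd X k (bd X k c) := by
  refine LinearMap.congr_fun (f := bd X k ∘ₗ sd X (k + 1)) (g := sd X k ∘ₗ bd X k)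
    (hom_ext fun σ => ?_) c
  rw [single_eq_map, LinearMap.comp_apply, LinearMap.comp_apply, sd_map_ofTuple, bd_map_ofTuple,
    bd_map_ofTuple, sd_map_ofTuple, TupleChain.bd_sd]

theorem bd_sdHomotopy (k : ℕ) (c : SingChain X (k + 1)) :
    bd X (k + 1) (sdHomotopy X (k + 1) c) = c - sd X (k + 1) c - sdHomotopy X k (bd X k c) := by
  refine LinearMap.congr_fun (f := bd X (k + 1) ∘ₗ sdHomotopy X (k + 1))
    (g := LinearMap.id - sd X (k + 1) - sdHomotopy X k ∘ₗ bd X k) (hom_ext fun σ => ?_) c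
  rw [single_eq_map]
  simp only [LinearMap.comp_apply, LinearMap.sub_apply, LinearMap.id_apply]
  rw [sdHomotopy_map_ofTuple, sd_map_ofTuple, bd_map_ofTuple, bd_map_ofTuple,
    sdHomotopy_map_ofTuple, TupleChain.bd_sdHomotopy]
  simp only [map_sub]

theorem sdHomotopy_zero (c : SingChain X 0) : sdHomotopy X 0 c = 0 := by
  refine LinearMap.congr_fun (f := sdHomotopy X 0) (g := 0) (hom_ext fun σ => ?_) c
  rw [single_eq_map, sdHomotopy_map_ofTuple]
  simp [TupleChain.sdHomotopy]

theorem map_sd (k : ℕ) (f : C(X, Y)) (c : SingChain X k) :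
    map k f (sd X k c) = sd Y k (map k f c) := by
  refine LinearMap.congr_fun (f := map k f ∘ₗ sd X k) (g := sd Y k ∘ₗ map k f)
    (hom_ext fun σ => ?_) c
  rw [single_eq_map, LinearMap.comp_apply, LinearMap.comp_apply, sd_map_ofTuple, ← map_comp,
    ← map_comp, sd_map_ofTuple]

end SingChain

/-! ### Iterated subdivisions are small -/

namespace TopSimplex

variable {j k l : ℕ}

theorem dist_comb_le {v : Fin j → TopSimplex k} {p : TopSimplex k} {r : ℝ}
    (h : ∀ i, dist (v i) p ≤ r) (s : TopSimplex j) : dist (comb v s) p ≤ r :=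
  (convex_closedBall (p : Fin k → ℝ) r).sum_mem (fun i _ => s.2.1 i) s.2.2
    (fun i _ => (h i : dist (v i : Fin k → ℝ) p ≤ r))

/-- The difference from `v i` is the average of the `k + 1` vectors `v j - v i`, one of which is
zero; this is where the factor `k / (k + 1)` comes from. -/
theorem dist_center_le {v : Fin (k + 1) → TopSimplex l} {r : ℝ}
    (h : ∀ i j, dist (v i) (v j) ≤ r) (i : Fin (k + 1)) :
    dist (center l k v) (v i) ≤ k / (k + 1) * r := by
  have hk : (0 : ℝ) < k + 1 := by positivity
  have hc : (center l k v : Fin l → ℝ) = ∑ j, (k + 1 : ℝ)⁻¹ • (v j : Fin l → ℝ) := by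
    change ∑ j, (Fintype.card (Fin (k + 1)) : ℝ)⁻¹ • (v j : Fin l → ℝ) = _
    simp
  have hv : (v i : Fin l → ℝ) = ∑ _j : Fin (k + 1), (k + 1 : ℝ)⁻¹ • (v i : Fin l → ℝ) := by
    rw [Finset.sum_const, Finset.card_univ, Fintype.card_fin, ← Nat.cast_smul_eq_nsmul ℝ, smul_smul]
    push_cast
    rw [mul_inv_cancel₀ hk.ne', one_smul]
  have hd : dist (center l k v) (v i) = ‖∑ j, (k + 1 : ℝ)⁻¹ • ((v j : Fin l → ℝ) - v i)‖ := by
    change dist (center l k v : Fin l → ℝ) (v i) = _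
    rw [dist_eq_norm, hc]
    conv_lhs => rw [hv]
    rw [← Finset.sum_sub_distrib]
    simp only [smul_sub]
  rw [hd, Fin.sum_univ_succAbove _ i, sub_self, smul_zero, zero_add]
  refine (norm_sum_le _ _).trans ((Finset.sum_le_card_nsmul _ _ ((k + 1 : ℝ)⁻¹ * r) ?_).trans ?_)
  · intro m _
    rw [norm_smul, Real.norm_of_nonneg (by positivity), ← dist_eq_norm]
    exact mul_le_mul_of_nonneg_left (h _ _) (by positivity)
  · rw [Finset.card_univ, Fintype.card_fin, nsmul_eq_mul, div_eq_mul_inv, mul_assoc]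

/-- The simplices of the barycentric subdivision of an affine simplex lie in that simplex and are
smaller by a constant factor. -/
theorem sd_single_mem {K : ℕ} (hk : k ≤ K + 1) {r : ℝ} (v : Fin k → TopSimplex l)
    (h : ∀ i j, dist (v i) (v j) ≤ r) :
    TupleChain.sd (center l) k (Finsupp.single v 1) ∈ TupleChain.of k fun w =>
      (∀ i, ∃ s, w i = comb v s) ∧ ∀ i j, dist (w i) (w j) ≤ K / (K + 1) * r := by
  induction k with
  | zero => exact TupleChain.single_mem_of ⟨fun i => i.elim0, fun i => i.elim0⟩
  | succ k ih =>
    have hr : 0 ≤ r := dist_nonneg.trans (h 0 0)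
    have hkK : (k : ℝ) / (k + 1) ≤ K / (K + 1) := by
      have : (k : ℝ) ≤ K := by exact_mod_cast Nat.succ_le_succ_iff.mp hk
      rw [div_le_div_iff₀ (by positivity) (by positivity)]
      linarith
    rw [TupleChain.sd_single, TupleChain.bd_single]
    simp only [map_sum, map_smul]
    refine Submodule.sum_mem _ fun m _ => Submodule.smul_mem _ _ ?_
    refine TupleChain.map_mem_of_forall (fun w hw => ?_)
      (ih (by omega) (v ∘ m.succAbove) fun i j => h _ _)
    rw [TupleChain.cone_single]
    have hw' : ∀ i, ∃ s, w i = comb v s := fun i => by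
      obtain ⟨s, hs⟩ := hw.1 i
      exact ⟨face m.succAbove s, by rw [hs, ← comb_comp_face]; rfl⟩
    -- The vertices of `w` lie in the convex hull of `v`, so their distance to the barycenter is
    -- bounded by that of the vertices of `v`.
    have hb : ∀ i, dist (w i) (center l k v) ≤ K / (K + 1) * r := fun i => by
      obtain ⟨s, hs⟩ := hw' i
      rw [hs]
      refine dist_comb_le (fun j => ?_) s
      rw [dist_comm]
      exact (dist_center_le h j).trans (mul_le_mul_of_nonneg_right hkK hr)
    refine TupleChain.single_mem_of ⟨fun i => ?_, fun i j => ?_⟩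
    · refine Fin.cases ?_ (fun i => ?_) i
      · exact ⟨_, rfl⟩
      · simpa using hw' i
    · refine Fin.cases ?_ (fun i => ?_) i <;> refine Fin.cases ?_ (fun j => ?_) j
      · simp only [dist_self]
        positivity
      · simpa [dist_comm] using hb j
      · simpa using hb i
      · simpa using hw.2 i j

theorem sd_pow_mem {K : ℕ} (hk : k ≤ K + 1) {r : ℝ} {c : TupleChain (TopSimplex l) k}
    (h : c ∈ TupleChain.of k fun v => ∀ i j, dist (v i) (v j) ≤ r) (N : ℕ) :
    (TupleChain.sd (center l) k ^ N) c ∈ TupleChain.of k fun v =>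
      ∀ i j, dist (v i) (v j) ≤ (K / (K + 1) : ℝ) ^ N * r := by
  induction N with
  | zero => simpa using h
  | succ N ih =>
    rw [pow_succ' (TupleChain.sd (center l) k), Module.End.mul_apply]
    refine TupleChain.map_mem_of_forall (fun v hv => ?_) ih
    refine Finsupp.supported_mono (fun w hw => ?_) (sd_single_mem hk v hv)
    intro i j
    simpa only [pow_succ', mul_assoc] using hw.2 i j

end TopSimplex

/-! ### Small singular chains -/

namespace SingChain

open TopSimplex

variable {X Y : Type*} [TopologicalSpace X] [TopologicalSpace Y] {k : ℕ}

/-- The singular chains of `X` whose simplices lie in `U`. -/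
def chainsIn (k : ℕ) (U : Set X) : Submodule ℚ (SingChain X k) :=
  Finsupp.supported ℚ ℚ {σ | ∀ s, σ s ∈ U}

theorem single_mem_chainsIn {U : Set X} {σ : C(TopSimplex k, X)} (h : ∀ s, σ s ∈ U) :
    Finsupp.single σ 1 ∈ chainsIn k U :=
  Finsupp.single_mem_supported ℚ _ h

theorem chainsIn_inter (U V : Set X) : chainsIn k (U ∩ V) = chainsIn k U ⊓ chainsIn k V := by
  rw [chainsIn, chainsIn, chainsIn, ← Finsupp.supported_inter]
  congr 1
  ext σ
  exact forall_and

theorem map_mem_chainsIn {U : Set Y} {f : C(X, Y)} (h : ∀ x, f x ∈ U) (c : SingChain X k) :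
    map k f c ∈ chainsIn k U := by
  induction c using Finsupp.induction_linear with
  | zero => simp
  | add a b ha hb => rw [map_add]; exact add_mem ha hb
  | single σ r =>
    rw [← mul_one r, ← smul_eq_mul, ← Finsupp.smul_single, map_smul, map_single]
    exact Submodule.smul_mem _ _ (single_mem_chainsIn fun s => h _)

/-- The inclusion of a subspace, as a continuous map. -/
def incl (U : Set X) : C(U, X) := ⟨Subtype.val, continuous_subtype_val⟩

theorem map_incl_injective (U : Set X) : Function.Injective (map k (incl U)) :=
  Finsupp.mapDomain_injective fun σ τ h => by
    ext s
    exact congr(($h) s)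

theorem exists_map_incl_eq {U : Set X} {c : SingChain X k} (hc : c ∈ chainsIn k U) :
    ∃ c' : SingChain U k, map k (incl U) c' = c := by
  have : chainsIn k U ≤ LinearMap.range (map k (incl U)) := by
    rw [chainsIn, Finsupp.supported_eq_span_single, Submodule.span_le]
    rintro _ ⟨σ, hσ, rfl⟩
    refine ⟨Finsupp.single ⟨fun s => ⟨σ s, hσ s⟩, σ.continuous.subtype_mk _⟩ 1, ?_⟩
    rw [map_single]
    rfl
  exact this hc

theorem bd_mem_chainsIn {U : Set X} {c : SingChain X (k + 1)} (hc : c ∈ chainsIn (k + 1) U) :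
    bd X k c ∈ chainsIn k U := by
  obtain ⟨c, rfl⟩ := exists_map_incl_eq hc
  rw [← map_bd]
  exact map_mem_chainsIn (fun x => x.2) _

theorem map_sd_pow (f : C(X, Y)) (N : ℕ) (c : SingChain X k) :
    map k f ((sd X k ^ N) c) = (sd Y k ^ N) (map k f c) := by
  induction N with
  | zero => rfl
  | succ N ih => rw [pow_succ', pow_succ', Module.End.mul_apply, Module.End.mul_apply, map_sd, ih]

theorem bd_sd_pow (N : ℕ) (c : SingChain X (k + 1)) :
    bd X k ((sd X (k + 1) ^ N) c) = (sd X k ^ N) (bd X k c) := by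
  induction N with
  | zero => rfl
  | succ N ih => rw [pow_succ', pow_succ', Module.End.mul_apply, Module.End.mul_apply, bd_sd, ih]

theorem sd_pow_mem_chainsIn {U : Set X} {c : SingChain X k} (hc : c ∈ chainsIn k U) (N : ℕ) :
    (sd X k ^ N) c ∈ chainsIn k U := by
  obtain ⟨c, rfl⟩ := exists_map_incl_eq hc
  rw [← map_sd_pow]
  exact map_mem_chainsIn (fun x => x.2) _

theorem sd_pow_map_ofTuple (j : ℕ) (σ : C(TopSimplex j, X)) (N : ℕ)
    (c : TupleChain (TopSimplex j) k) : (sd X k ^ N) (map k σ (ofTuple j k c)) =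
      map k σ (ofTuple j k ((TupleChain.sd (center j) k ^ N) c)) := by
  induction N with
  | zero => rfl
  | succ N ih =>
    rw [pow_succ', pow_succ', Module.End.mul_apply, Module.End.mul_apply, ih, sd_map_ofTuple]

/-- Iterated barycentric subdivision makes every singular chain small of the order of a given open
cover. -/
theorem eventually_sd_pow_mem {U V : Set X} (hU : IsOpen U) (hV : IsOpen V)
    (hUV : U ∪ V = Set.univ) (c : SingChain X k) :
    ∀ᶠ N in Filter.atTop, (sd X k ^ N) c ∈ chainsIn k U ⊔ chainsIn k V := by
  induction c using Finsupp.induction_linear with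
  | zero => simp
  | add a b ha hb =>
    -- Asking for all large `N` lets the two summands share one `N`.
    filter_upwards [ha, hb] with N ha hb
    rw [map_add]
    exact add_mem ha hb
  | single σ r =>
    obtain ⟨δ, hδ, hball⟩ := lebesgue_number_lemma_of_metric
      (s := (Set.univ : Set (TopSimplex k))) (c := fun b : Bool => σ ⁻¹' (bif b then U else V))
      isCompact_univ
      (fun b => by cases b; exacts [hV.preimage σ.continuous, hU.preimage σ.continuous])
      (fun s _ => by
        rcases (hUV ▸ Set.mem_univ (σ s) : σ s ∈ U ∪ V) with h | h
        exacts [Set.mem_iUnion.2 ⟨true, h⟩, Set.mem_iUnion.2 ⟨false, h⟩])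
    obtain ⟨R, hR⟩ : ∃ R, ∀ i j, dist (vertices k i) (vertices k j) ≤ R := by
      obtain ⟨R, hR⟩ := Metric.isBounded_iff.1 (Set.finite_range (vertices k)).isBounded
      exact ⟨R, fun i j => hR ⟨i, rfl⟩ ⟨j, rfl⟩⟩
    have hlim : Filter.Tendsto (fun N : ℕ => (k / (k + 1) : ℝ) ^ N * R) Filter.atTop (nhds 0) := by
      rw [← zero_mul R]
      refine (tendsto_pow_atTop_nhds_zero_of_lt_one (by positivity) ?_).mul_const R
      rw [div_lt_one (by positivity)]
      linarith
    filter_upwards [hlim.eventually_lt_const hδ] with N hN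
    rw [← mul_one r, ← smul_eq_mul, ← Finsupp.smul_single, map_smul, single_eq_map,
      sd_pow_map_ofTuple]
    refine Submodule.smul_mem _ _ ?_
    refine TupleChain.map_mem_of_forall (f := map k σ ∘ₗ ofTuple k k) (fun v hv => ?_)
      (sd_pow_mem (K := k) (by omega)
        (TupleChain.single_mem_of (p := fun v => ∀ i j, dist (v i) (v j) ≤ R) hR) N)
    rw [LinearMap.comp_apply, ofTuple_single, map_single]
    rcases Nat.eq_zero_or_pos k with rfl | hk
    -- The simplex with no vertices is empty: its coordinates would have to sum to `1`.
    · refine Submodule.mem_sup_left (single_mem_chainsIn fun s => ?_)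
      have := s.2.2
      simp at this
    · obtain ⟨b, hb⟩ := hball (v ⟨0, hk⟩) (Set.mem_univ _)
      have key : ∀ s, (σ.comp (comb v)) s ∈ bif b then U else V := fun s =>
        hb (lt_of_le_of_lt (dist_comb_le (fun i => hv _ _) s) hN)
      cases b
      exacts [Submodule.mem_sup_right (single_mem_chainsIn key),
        Submodule.mem_sup_left (single_mem_chainsIn key)]

/-- If a chain in `U` and a chain in `V` differ by a boundary, then a subdivision of their common
boundary bounds in `U ∩ V`. -/
theorem exists_bd_eq_sd_pow_bd {U V : Set X} (hU : IsOpen U) (hV : IsOpen V)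
    (hUV : U ∪ V = Set.univ) {a b : SingChain X (k + 1)} (ha : a ∈ chainsIn (k + 1) U)
    (hb : b ∈ chainsIn (k + 1) V) {w : SingChain X (k + 2)} (hw : bd X (k + 1) w = a - b) :
    ∃ N, ∃ c ∈ chainsIn (k + 1) (U ∩ V), bd X k c = (sd X k ^ N) (bd X k a) := by
  obtain ⟨N, hN⟩ := (eventually_sd_pow_mem hU hV hUV w).exists
  obtain ⟨u, hu, v, hv, huv⟩ := Submodule.mem_sup.1 hN
  -- Write the subdivided `w` as `u + v` with `u` in `U` and `v` in `V`. Then `sd^N a - bd u = sd^N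
  -- b + bd v`; the left side lies in `U` and the right side in `V`.
  refine ⟨N, (sd X (k + 1) ^ N) a - bd X (k + 1) u, ?_, ?_⟩
  · rw [chainsIn_inter]
    refine ⟨sub_mem (sd_pow_mem_chainsIn ha N) (bd_mem_chainsIn hu), ?_⟩
    have : (sd X (k + 1) ^ N) a - bd X (k + 1) u = (sd X (k + 1) ^ N) b + bd X (k + 1) v := by
      rw [sub_eq_iff_eq_add, add_assoc, ← map_add, add_comm v u, huv, bd_sd_pow, hw, map_sub]
      abel
    rw [this]
    exact add_mem (sd_pow_mem_chainsIn hb N) (bd_mem_chainsIn hv)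
  · rw [map_sub, bd_bd, sub_zero, bd_sd_pow]

end SingChain

/-! ### Comparison with the singular chain complex of Mathlib -/

namespace SingChain

open TopSimplex AlgebraicTopology

/-- The rational singular chain complex. -/
noncomputable abbrev complex (X : Type) [TopologicalSpace X] : ChainComplex (ModuleCat.{0} ℚ) ℕ :=
  (TopCat.toSSet.obj (TopCat.of X)).chainComplex (ModuleCat.of ℚ ℚ)

variable {X Y : Type} [TopologicalSpace X] [TopologicalSpace Y]

/-- A singular simplex, as an element of the singular simplicial set. -/
noncomputable def toSSetEquiv (X : Type) [TopologicalSpace X] (n : ℕ) :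
    C(TopSimplex (n + 1), X) ≃ (TopCat.toSSet.obj (TopCat.of X)).obj (.op (SimplexCategory.mk n)) :=
  ((TopCat.of X).toSSetObjEquiv (.op (SimplexCategory.mk n))).symm

theorem δ_toSSetEquiv (n : ℕ) (σ : C(TopSimplex (n + 2), X)) (i : Fin (n + 2)) :
    (TopCat.toSSet.obj (TopCat.of X)).δ i (toSSetEquiv X (n + 1) σ) =
      toSSetEquiv X n (σ.comp (face i.succAbove)) := rfl

/-- The comparison of singular chains with the singular chain complex. -/
noncomputable def toComplex (X : Type) [TopologicalSpace X] (n : ℕ) :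
    SingChain X (n + 1) →ₗ[ℚ] (complex X).X n :=
  Finsupp.lift _ ℚ _ fun σ =>
    (SSet.ιChainComplex (R := ModuleCat.of ℚ ℚ) _ (toSSetEquiv X n σ)).hom (1 : ℚ)

theorem toComplex_single (n : ℕ) (σ : C(TopSimplex (n + 1), X)) :
    toComplex X n (Finsupp.single σ 1) =
      (SSet.ιChainComplex (R := ModuleCat.of ℚ ℚ) _ (toSSetEquiv X n σ)).hom (1 : ℚ) := by
  rw [toComplex, Finsupp.lift_apply, Finsupp.sum_single_index (by simp), one_smul]

/-- The inverse of the comparison `SingChain.toComplex`. -/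
noncomputable def ofComplex (X : Type) [TopologicalSpace X] (n : ℕ) :
    (complex X).X n ⟶ ModuleCat.of ℚ (SingChain X (n + 1)) :=
  Limits.Cofan.IsColimit.desc (SSet.isColimitChainComplexXCofan _ (ModuleCat.of ℚ ℚ) n)
    fun x => ModuleCat.ofHom (LinearMap.toSpanSingleton ℚ _
      (Finsupp.single ((toSSetEquiv X n).symm x) (1 : ℚ)))

theorem ofComplex_toComplex (n : ℕ) (c : SingChain X (n + 1)) :
    (ofComplex X n).hom (toComplex X n c) = c := by
  refine LinearMap.congr_fun (f := (ofComplex X n).hom ∘ₗ toComplex X n) (g := LinearMap.id)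
    (hom_ext fun σ => ?_) c
  rw [LinearMap.comp_apply, toComplex_single]
  have := congr(($(Limits.Cofan.IsColimit.fac
    (SSet.isColimitChainComplexXCofan _ (ModuleCat.of ℚ ℚ) n)
    (fun x => ModuleCat.ofHom (LinearMap.toSpanSingleton ℚ _
      (Finsupp.single ((toSSetEquiv X n).symm x) (1 : ℚ)))) (toSSetEquiv X n σ))).hom (1 : ℚ))
  exact this.trans (one_smul ℚ _)

theorem toComplex_ofComplex (n : ℕ) (x : (complex X).X n) :
    toComplex X n ((ofComplex X n).hom x) = x := by
  have : ofComplex X n ≫ ModuleCat.ofHom (toComplex X n) = 𝟙 _ := by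
    refine SSet.chainComplex_hom_ext fun x => ?_
    ext
    obtain ⟨σ, rfl⟩ := (toSSetEquiv X n).surjective x
    have h := ofComplex_toComplex n (Finsupp.single σ 1)
    rw [toComplex_single] at h
    have h' := toComplex_single n σ
    rw [← h] at h'
    exact h'
  exact congr(($this).hom x)

theorem d_toComplex (n : ℕ) (c : SingChain X (n + 2)) :
    ((complex X).d (n + 1) n).hom (toComplex X (n + 1) c) = toComplex X n (bd X (n + 1) c) := by
  refine LinearMap.congr_fun (f := ((complex X).d (n + 1) n).hom ∘ₗ toComplex X (n + 1))
    (g := toComplex X n ∘ₗ bd X (n + 1)) (hom_ext fun σ => ?_) c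
  simp only [LinearMap.comp_apply, toComplex_single, bd_single, map_sum, map_smul]
  have := congr(($(SSet.ιChainComplex_d (TopCat.toSSet.obj (TopCat.of X)) (ModuleCat.of ℚ ℚ)
    (toSSetEquiv X (n + 1) σ))).hom (1 : ℚ))
  refine this.trans ?_
  simp only [ModuleCat.hom_sum, LinearMap.sum_apply]
  refine Finset.sum_congr rfl fun i _ => ?_
  rw [δ_toSSetEquiv, ModuleCat.hom_zsmul, LinearMap.smul_apply, ← Int.cast_smul_eq_zsmul ℚ]
  push_cast
  rfl

theorem map_toComplex (n : ℕ) (f : C(X, Y)) (c : SingChain X (n + 1)) :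
    ((SSet.chainComplexMap (TopCat.toSSet.map (TopCat.ofHom f)) (ModuleCat.of ℚ ℚ)).f n).hom
      (toComplex X n c) = toComplex Y n (map (n + 1) f c) := by
  refine LinearMap.congr_fun (f := ((SSet.chainComplexMap (TopCat.toSSet.map (TopCat.ofHom f))
    (ModuleCat.of ℚ ℚ)).f n).hom ∘ₗ toComplex X n)
    (g := toComplex Y n ∘ₗ map (n + 1) f) (hom_ext fun σ => ?_) c
  simp only [LinearMap.comp_apply, toComplex_single, map_single]
  exact congr(($(SSet.ι_chainComplexMap_f _ _ (TopCat.toSSet.map (TopCat.ofHom f))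
    (ModuleCat.of ℚ ℚ) (toSSetEquiv X n σ))).hom (1 : ℚ))

/-! ### Rational singular homology -/

/-- The singular `n`-cycles. -/
noncomputable def cycles (X : Type) [TopologicalSpace X] :
    ∀ n : ℕ, Submodule ℚ (SingChain X (n + 1))
  -- Here `bd X 0` is the augmentation; ignoring it makes the homology unreduced.
  | 0 => ⊤
  | n + 1 => LinearMap.ker (bd X (n + 1))

/-- The singular `n`-boundaries. -/
noncomputable def boundaries (X : Type) [TopologicalSpace X] (n : ℕ) :
    Submodule ℚ (SingChain X (n + 1)) :=
  LinearMap.range (bd X (n + 1))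

theorem boundaries_le_cycles (n : ℕ) : boundaries X n ≤ cycles X n := by
  rintro _ ⟨c, rfl⟩
  cases n with
  | zero => trivial
  | succ n => exact bd_bd _ c

/-- The target `j` is arbitrary because homotopies and dual complexes produce the neighbouring index
of the complex shape, which in degree `0` may be `0` itself. -/
theorem d_toComplex_of_mem_cycles {n : ℕ} {c : SingChain X (n + 1)} (hc : c ∈ cycles X n) (j : ℕ) :
    ((complex X).d n j).hom (toComplex X n c) = 0 := by
  by_cases h : j + 1 = n
  · subst h
    rw [d_toComplex, show bd X (j + 1) c = 0 from hc, map_zero]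
  · rw [(complex X).shape _ _ h]
    rfl

theorem ofComplex_d_mem_boundaries (n j : ℕ) (x : (complex X).X j) :
    (ofComplex X n).hom (((complex X).d j n).hom x) ∈ boundaries X n := by
  by_cases h : n + 1 = j
  · subst h
    rw [← toComplex_ofComplex (n + 1) x, d_toComplex, ofComplex_toComplex]
    exact ⟨_, rfl⟩
  · rw [(complex X).shape _ _ h]
    exact (map_zero (ofComplex X n).hom).symm ▸ (boundaries X n).zero_mem

/-- Homotopic maps agree on homology. -/
theorem map_sub_map_mem_boundaries {f g : C(X, Y)} (F : ContinuousMap.Homotopy f g) {n : ℕ}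
    {c : SingChain X (n + 1)} (hc : c ∈ cycles X n) :
    map (n + 1) f c - map (n + 1) g c ∈ boundaries Y n := by
  let H : _root_.Homotopy
      (SSet.chainComplexMap (TopCat.toSSet.map (TopCat.ofHom f)) (ModuleCat.of ℚ ℚ))
      (SSet.chainComplexMap (TopCat.toSSet.map (TopCat.ofHom g)) (ModuleCat.of ℚ ℚ)) :=
    TopCat.Homotopy.singularChainComplexFunctorObjMap (f := TopCat.ofHom f)
      (g := TopCat.ofHom g) F (ModuleCat.of ℚ ℚ)
  have h := congr((ofComplex Y n).hom (($(H.comm n)).hom (toComplex X n c)))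
  rw [map_toComplex] at h
  change _ = (ofComplex Y n).hom ((H.hom _ _).hom (((complex X).d n _).hom (toComplex X n c)) +
    ((complex Y).d _ n).hom ((H.hom n _).hom (toComplex X n c)) + ((SSet.chainComplexMap
    (TopCat.toSSet.map (TopCat.ofHom g)) (ModuleCat.of ℚ ℚ)).f n).hom (toComplex X n c)) at h
  rw [map_toComplex, d_toComplex_of_mem_cycles hc, map_zero, zero_add, map_add,
    ofComplex_toComplex, ofComplex_toComplex] at h
  rw [h, add_sub_cancel_right]
  exact ofComplex_d_mem_boundaries n _ _

end SingChain

/-! ### Homology and its comparison with cohomology -/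

namespace SingChain

variable {X Y : Type} [TopologicalSpace X] [TopologicalSpace Y]

/-- The rational singular homology of `X`. -/
def Homology (X : Type) [TopologicalSpace X] (n : ℕ) : Type :=
  cycles X n ⧸ (boundaries X n).submoduleOf (cycles X n)

noncomputable instance (n : ℕ) : AddCommGroup (Homology X n) :=
  inferInstanceAs (AddCommGroup (cycles X n ⧸ (boundaries X n).submoduleOf (cycles X n)))

noncomputable instance (n : ℕ) : Module ℚ (Homology X n) :=
  inferInstanceAs (Module ℚ (cycles X n ⧸ (boundaries X n).submoduleOf (cycles X n)))

/-- The homology class of a cycle. -/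
noncomputable def homologyClass (X : Type) [TopologicalSpace X] (n : ℕ) :
    cycles X n →ₗ[ℚ] Homology X n :=
  ((boundaries X n).submoduleOf (cycles X n)).mkQ

theorem homologyClass_surjective (n : ℕ) : Function.Surjective (homologyClass X n) :=
  Submodule.mkQ_surjective _

theorem homologyClass_eq_zero_iff {n : ℕ} (c : cycles X n) :
    homologyClass X n c = 0 ↔ (c : SingChain X (n + 1)) ∈ boundaries X n := by
  exact Submodule.Quotient.mk_eq_zero _

theorem map_mem_boundaries {n : ℕ} (f : C(X, Y)) {c : SingChain X (n + 1)}
    (hc : c ∈ boundaries X n) : map (n + 1) f c ∈ boundaries Y n := by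
  obtain ⟨w, rfl⟩ := hc
  exact ⟨map _ f w, (map_bd _ f w).symm⟩

theorem map_mem_cycles {n : ℕ} (f : C(X, Y)) {c : SingChain X (n + 1)}
    (hc : c ∈ cycles X n) : map (n + 1) f c ∈ cycles Y n := by
  cases n with
  | zero => trivial
  | succ n => exact (map_bd _ f c).symm.trans (by rw [show bd X (n + 1) c = 0 from hc, map_zero])

/-- The map induced on cycles. -/
noncomputable def cyclesMap (n : ℕ) (f : C(X, Y)) : cycles X n →ₗ[ℚ] cycles Y n :=
  (map (n + 1) f).restrict fun _ h => map_mem_cycles f h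

/-- The map induced on homology. -/
noncomputable def homologyMap (n : ℕ) (f : C(X, Y)) : Homology X n →ₗ[ℚ] Homology Y n :=
  Submodule.mapQ _ _ (cyclesMap n f) fun _ h => map_mem_boundaries f h

/-- Half of the universal coefficient theorem. A functional on homology extends to all chains along
a projection `e` onto the cycles. The extension kills boundaries, so it is a cocycle; if it is a
coboundary, it vanishes on cycles, so the functional was zero. -/
theorem rank_dual_homology_le (X : Type) [TopologicalSpace X] (n : ℕ) :
    Module.rank ℚ (Module.Dual ℚ (Homology X n)) ≤ Module.rank ℚ (rationalCohomology X n) := by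
  let S := (rationalSingularCochainComplex X).sc n
  obtain ⟨e, he⟩ := (cycles X n).subtype.exists_leftInverse_of_injective (Submodule.ker_subtype _)
  replace he : ∀ c : cycles X n, e c = c := LinearMap.congr_fun he
  let L₀ : Module.Dual ℚ (Homology X n) →ₗ[ℚ] S.X₂ :=
    { toFun φ := (ofComplex X n ≫ ModuleCat.ofHom (φ ∘ₗ homologyClass X n ∘ₗ e) :
        (complex X).X n ⟶ ModuleCat.of ℚ ℚ)
      map_add' _ _ := rfl
      map_smul' _ _ := rfl }
  have hL₀ : ∀ φ, L₀ φ ∈ LinearMap.ker S.g.hom := fun φ => by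
    rw [LinearMap.mem_ker]
    change (complex X).d _ n ≫ ofComplex X n ≫ ModuleCat.ofHom (φ ∘ₗ homologyClass X n ∘ₗ e) = 0
    ext x
    have h := ofComplex_d_mem_boundaries n _ x
    change φ (homologyClass X n (e ((ofComplex X n).hom (((complex X).d _ n).hom x)))) = 0
    rw [he ⟨_, boundaries_le_cycles n h⟩,
      (homologyClass_eq_zero_iff _).2 h, map_zero]
  let L : Module.Dual ℚ (Homology X n) →ₗ[ℚ]
      LinearMap.ker S.g.hom ⧸ LinearMap.range S.moduleCatToCycles :=
    (LinearMap.range S.moduleCatToCycles).mkQ ∘ₗ L₀.codRestrict _ hL₀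
  have hL : Function.Injective L := by
    rw [← LinearMap.ker_eq_bot, LinearMap.ker_eq_bot']
    intro φ hφ
    obtain ⟨y, hy⟩ : ∃ y : (complex X).X ((ComplexShape.up ℕ).prev n) ⟶ ModuleCat.of ℚ ℚ,
        (complex X).d n _ ≫ y = ofComplex X n ≫
          ModuleCat.ofHom (φ ∘ₗ homologyClass X n ∘ₗ e) := by
      obtain ⟨y, hy⟩ := (Submodule.Quotient.mk_eq_zero _).1 hφ
      exact ⟨y, congr(($hy).1)⟩
    refine LinearMap.ext fun x => ?_
    obtain ⟨c, rfl⟩ := homologyClass_surjective n x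
    have h : y.hom (((complex X).d n _).hom (toComplex X n c)) = φ (homologyClass X n
      (e ((ofComplex X n).hom (toComplex X n c)))) := congr(($hy).hom (toComplex X n c))
    rw [d_toComplex_of_mem_cycles c.2, map_zero, ofComplex_toComplex,
      he] at h
    exact h.symm
  exact (LinearMap.rank_le_of_injective L hL).trans_eq
    S.moduleCatHomologyIso.symm.toLinearEquiv.rank_eq

theorem rank_homology_le (X : Type) [TopologicalSpace X] (n : ℕ) :
    Module.rank ℚ (Homology X n) ≤ Module.rank ℚ (rationalCohomology X n) := by
  classical
  exact (LinearMap.rank_le_of_injective _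
    (Module.Basis.ofVectorSpace ℚ (Homology X n)).toDual_injective).trans
    (rank_dual_homology_le X n)

/-- The total rank of the rational singular homology. -/
noncomputable def totalRank (X : Type) [TopologicalSpace X] : Cardinal.{0} :=
  Cardinal.sum fun n : ℕ => Module.rank ℚ (Homology X n)

theorem totalRank_le_hrk (X : Type) [TopologicalSpace X] : totalRank X ≤ hrk X :=
  Cardinal.sum_le_sum _ _ fun n => rank_homology_le X n

end SingChain

/-! ### The Mayer–Vietoris estimate -/

/-- `S` lies in `range π`, a quotient of `range Φ` because `ker Φ ≤ ker π`. This lets a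
correspondence `G` play the role of the connecting homomorphism without any choice of lifts. -/
theorem Submodule.rank_le_of_le_range {G W Q : Type} [AddCommGroup G] [Module ℚ G]
    [AddCommGroup W] [Module ℚ W] [AddCommGroup Q] [Module ℚ Q] (S : Submodule ℚ W)
    (π : G →ₗ[ℚ] W) (Φ : G →ₗ[ℚ] Q) (hS : ∀ x ∈ S, ∃ t, π t = x) (h : ∀ t, Φ t = 0 → π t = 0) :
    Module.rank ℚ S ≤ Module.rank ℚ Q :=
  calc Module.rank ℚ S
      ≤ Module.rank ℚ (LinearMap.range π) := Submodule.rank_mono hS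
    _ = Module.rank ℚ (G ⧸ LinearMap.ker π) := π.quotKerEquivRange.rank_eq.symm
    _ ≤ Module.rank ℚ (G ⧸ LinearMap.ker Φ) :=
      LinearMap.rank_le_of_surjective _ (Submodule.factor_surjective h)
    _ = Module.rank ℚ (LinearMap.range Φ) := Φ.quotKerEquivRange.rank_eq
    _ ≤ Module.rank ℚ Q := Submodule.rank_le _

namespace SingChain

variable {X : Type} [TopologicalSpace X]

theorem sd_pow_sub_mem_boundaries {n : ℕ} {c : SingChain X (n + 1)} (hc : c ∈ cycles X n) (N : ℕ) :
    (sd X (n + 1) ^ N) c - c ∈ boundaries X n := by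
  induction N with
  | zero => simp
  | succ N ih =>
    have h : ∀ c ∈ cycles X n, sd X (n + 1) c - c ∈ boundaries X n := fun c hc => by
      refine ⟨-sdHomotopy X (n + 1) c, ?_⟩
      -- For `n = 0` the augmentation of `c` need not vanish, but the homotopy is zero on chains
      -- without vertices.
      have : sdHomotopy X n (bd X n c) = 0 := by
        cases n with
        | zero => exact sdHomotopy_zero _
        | succ n => rw [show bd X (n + 1) c = 0 from hc, map_zero]
      rw [map_neg, bd_sdHomotopy, this]
      abel
    rw [pow_succ', Module.End.mul_apply, ← sub_add_sub_cancel _ ((sd X (n + 1) ^ N) c)]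
    refine add_mem (h _ ?_) ih
    rw [← sub_add_cancel ((sd X (n + 1) ^ N) c) c]
    exact add_mem (boundaries_le_cycles n ih) hc

variable {Y Z : Type} [TopologicalSpace Y] [TopologicalSpace Z] {U V : Set X}

/-- The chains in `U` and in `V` with common boundary a given cycle in `U ∩ V`. -/
noncomputable def gluingData (U V : Set X) (i : C(Z, X)) (n : ℕ) :
    Submodule ℚ (cycles Z n × SingChain X (n + 2) × SingChain X (n + 2)) where
  carrier := {t | t.2.1 ∈ chainsIn (n + 2) U ∧ t.2.2 ∈ chainsIn (n + 2) V ∧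
    bd X (n + 1) t.2.1 = map (n + 1) i t.1 ∧ bd X (n + 1) t.2.2 = map (n + 1) i t.1}
  add_mem' := fun ⟨h₁, h₂, h₃, h₄⟩ ⟨k₁, k₂, k₃, k₄⟩ =>
    ⟨add_mem h₁ k₁, add_mem h₂ k₂, by simp [h₃, k₃], by simp [h₄, k₄]⟩
  zero_mem' := ⟨zero_mem _, zero_mem _, by simp, by simp⟩
  smul_mem' r _ := fun ⟨h₁, h₂, h₃, h₄⟩ =>
    ⟨Submodule.smul_mem _ r h₁, Submodule.smul_mem _ r h₂, by simp [h₃], by simp [h₄]⟩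

/-- The cycle glued from a chain in `U` and a chain in `V`. -/
noncomputable def glue (U V : Set X) (i : C(Z, X)) (n : ℕ) :
    gluingData U V i n →ₗ[ℚ] cycles X (n + 1) :=
  LinearMap.codRestrict _ ((LinearMap.fst ℚ _ _ - LinearMap.snd ℚ _ _) ∘ₗ
    LinearMap.snd ℚ _ _ ∘ₗ (gluingData U V i n).subtype) fun t => by
      change bd X (n + 1) (t.1.2.1 - t.1.2.2) = 0
      rw [map_sub, t.2.2.2.1, t.2.2.2.2, sub_self]

variable (hU : IsOpen U) (hV : IsOpen V) (hUV : U ∪ V = Set.univ)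
  (i : C(Z, ↥(U ∩ V))) (q : C(↥(U ∩ V), Z)) (hq : q.comp i = .id Z)
  (f : C(Z, Y)) (jU : C(Y, U)) (jV : C(Y, V))
  (p : C(X, Y)) (hp : p.comp ((incl U).comp jU) = .id Y)
  (FU : ContinuousMap.Homotopy (⟨fun z => ⟨i z, (i z).2.1⟩, by fun_prop⟩ : C(Z, U)) (jU.comp f))
  (FV : ContinuousMap.Homotopy (⟨fun z => ⟨i z, (i z).2.2⟩, by fun_prop⟩ : C(Z, V)) (jV.comp f))

include hU hV hUV hq in
-- If `a - b` is homologous to a cycle `y` in `U`, then `a - y` in `U` and `b` in `V` differ by a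
-- boundary. So a subdivision of `z` bounds in `U ∩ V`, and `q` carries this to `Z`, where the
-- subdivision is homologous to `z`. A retraction suffices; no deformation is needed.
theorem mem_boundaries_of_glue {n : ℕ} (t : gluingData U V ((incl (U ∩ V)).comp i) n)
    {y : SingChain X (n + 2)} (hy : y ∈ chainsIn (n + 2) U) (hy' : y ∈ cycles X (n + 1))
    (h : (glue U V _ n t : SingChain X (n + 2)) - y ∈ boundaries X (n + 1)) :
    (t.1.1 : SingChain Z (n + 1)) ∈ boundaries Z n := by
  obtain ⟨⟨z, a, b⟩, ha, hb, hza, hzb⟩ := t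
  obtain ⟨w, hw⟩ := h
  replace hw : bd X (n + 2) w = (a - y) - b := hw.trans (by
    change a - b - y = _
    abel)
  obtain ⟨N, c, hc, hcN⟩ := exists_bd_eq_sd_pow_bd hU hV hUV (sub_mem ha hy) hb hw
  obtain ⟨c, rfl⟩ := exists_map_incl_eq hc
  replace hza : bd X (n + 1) a = map (n + 1) ((incl (U ∩ V)).comp i) z := hza
  rw [map_sub, show bd X (n + 1) y = 0 from hy', sub_zero, hza, map_comp, ← map_sd_pow,
    ← map_bd] at hcN
  have hz : map (n + 1) q (bd _ (n + 1) c) = (sd Z (n + 1) ^ N) z := by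
    rw [map_incl_injective _ hcN, map_sd_pow, ← map_comp, hq, map_id]
  have := sd_pow_sub_mem_boundaries z.2 N
  rw [← hz, map_bd] at this
  simpa using sub_mem (show bd Z (n + 1) (map _ q c) ∈ boundaries Z n from ⟨_, rfl⟩) this

include FU FV in
-- In `U`, the homotopy joins `z` to its image through `f`, and a filling of that image in `Y`
-- closes it off. The same filling serves in `V`.
theorem exists_gluingData {n : ℕ} (z : cycles Z n)
    (hz : map (n + 1) f (z : SingChain Z (n + 1)) ∈ boundaries Y n) :
    ∃ t : gluingData U V ((incl (U ∩ V)).comp i) n, t.1.1 = z := by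
  obtain ⟨y, hy⟩ := hz
  obtain ⟨a, ha⟩ := map_sub_map_mem_boundaries FU z.2
  obtain ⟨b, hb⟩ := map_sub_map_mem_boundaries FV z.2
  rw [map_comp, ← hy, map_bd, eq_sub_iff_add_eq, ← map_add] at ha hb
  refine ⟨⟨(z, map _ (incl U) (a + map _ jU y), map _ (incl V) (b + map _ jV y)),
    map_mem_chainsIn (fun x => x.2) _, map_mem_chainsIn (fun x => x.2) _, ?_, ?_⟩, rfl⟩
  · change bd X (n + 1) (map _ _ _) = _
    rw [← map_bd, ha, ← map_comp]
    rfl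
  · change bd X (n + 1) (map _ _ _) = _
    rw [← map_bd, hb, ← map_comp]
    rfl

include hU hV hUV hq FU FV in
theorem rank_ker_homologyMap_le (n : ℕ) : Module.rank ℚ (LinearMap.ker (homologyMap n f)) ≤
    Module.rank ℚ (Homology X (n + 1) ⧸
      LinearMap.range (homologyMap (n + 1) ((incl U).comp jU))) := by
  refine Submodule.rank_le_of_le_range (G := gluingData U V ((incl (U ∩ V)).comp i) n)
    (W := Homology Z n) (LinearMap.ker (homologyMap n f))
    (homologyClass Z n ∘ₗ LinearMap.fst ℚ _ _ ∘ₗ Submodule.subtype _)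
    ((LinearMap.range (homologyMap (n + 1) ((incl U).comp jU))).mkQ ∘ₗ
      homologyClass X (n + 1) ∘ₗ glue U V ((incl (U ∩ V)).comp i) n) (fun x hx => ?_) fun t ht => ?_
  · obtain ⟨z, rfl⟩ := homologyClass_surjective n x
    obtain ⟨t, ht⟩ := exists_gluingData i f jU jV FU FV z
      ((homologyClass_eq_zero_iff (cyclesMap n f z)).1 hx)
    exact ⟨t, congrArg (homologyClass Z n) ht⟩
  obtain ⟨y, hy⟩ : homologyClass X (n + 1) (glue U V ((incl (U ∩ V)).comp i) n t) ∈
      LinearMap.range (homologyMap (n + 1) ((incl U).comp jU)) := by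
    rwa [LinearMap.comp_apply, LinearMap.comp_apply, Submodule.mkQ_apply,
      Submodule.Quotient.mk_eq_zero] at ht
  obtain ⟨y, rfl⟩ := homologyClass_surjective _ y
  have hy' : homologyClass X (n + 1) (glue U V ((incl (U ∩ V)).comp i) n t -
      cyclesMap (n + 1) ((incl U).comp jU) y) = 0 := by
    rw [map_sub, sub_eq_zero]
    exact hy.symm
  exact (homologyClass_eq_zero_iff t.1.1).2 (mem_boundaries_of_glue hU hV hUV i q hq t
    (map_mem_chainsIn (f := (incl U).comp jU) (fun x => (jU x).2) y.1)
    (cyclesMap (n + 1) ((incl U).comp jU) y).2 ((homologyClass_eq_zero_iff _).1 hy'))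

include hU hV hUV hq hp FU FV in
/-- If `X` is covered by open sets `U` and `V` such that `U ∩ V` retracts to `Z`, the inclusions of
`Z` in `U` and in `V` factor up to homotopy through `f : Z → Y`, and `Y → U → X` has a retraction,
then the total rank of the homology of `Z` is at most that of `X`. -/
theorem totalRank_le_of_openCover : totalRank Z ≤ totalRank X := by
  have hinj : ∀ n, Function.Injective (homologyMap n ((incl U).comp jU)) := fun n => by
    refine Function.LeftInverse.injective (g := homologyMap n p) fun x => ?_
    obtain ⟨c, rfl⟩ := homologyClass_surjective _ x
    have : cyclesMap n p (cyclesMap n ((incl U).comp jU) c) = c :=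
      Subtype.ext ((map_comp _ _ _ _).symm.trans (by rw [hp, map_id]; rfl))
    exact congr(homologyClass Y n $this)
  let Q : ℕ → Cardinal.{0} := fun n =>
    Module.rank ℚ (Homology X n ⧸ LinearMap.range (homologyMap n ((incl U).comp jU)))
  let J : ℕ → Cardinal.{0} := fun n =>
    Module.rank ℚ (LinearMap.range (homologyMap n ((incl U).comp jU)))
  have hX : totalRank X = Cardinal.sum Q + Cardinal.sum J := by
    rw [← Cardinal.sum_add_distrib]
    exact congrArg Cardinal.sum (funext fun n => (Submodule.rank_quotient_add_rank _).symm)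
  have hZ : totalRank Z = (Cardinal.sum fun n => Module.rank ℚ (LinearMap.ker (homologyMap n f))) +
      Cardinal.sum fun n => Module.rank ℚ (LinearMap.range (homologyMap n f)) := by
    rw [← Cardinal.sum_add_distrib]
    exact congrArg Cardinal.sum (funext fun n =>
      (add_comm _ _).trans (LinearMap.rank_range_add_rank_ker (homologyMap n f)) |>.symm)
  rw [hX, hZ]
  refine add_le_add ?_ (Cardinal.sum_le_sum _ _ fun n => ?_)
  -- Kernels in degree `n` are matched with quotients in degree `n + 1`; the quotient in degree `0`
  -- is discarded.
  · rw [Cardinal.sum_nat_eq_add_sum_succ Q]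
    exact (Cardinal.sum_le_sum _ _ fun n =>
      rank_ker_homologyMap_le hU hV hUV i q hq f jU jV FU FV n).trans le_add_self
  · exact (Submodule.rank_le _).trans_eq (LinearEquiv.ofInjective _ (hinj n)).rank_eq

end SingChain

/-! ### Discrete spaces and hyperplane slices -/

namespace SingChain

/-- Singular simplices are constant, so evaluating `0`-chains at their points kills boundaries and
maps `H_0` onto the free space on `T`. -/
theorem mk_le_totalRank (T : Type) [TopologicalSpace T] [TotallyDisconnectedSpace T] :
    Cardinal.mk T ≤ totalRank T := by
  have hconst : ∀ {k : ℕ} (σ : C(TopSimplex (k + 1), T)) (s t), σ s = σ t := fun σ s t =>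
    (isPreconnected_range σ.continuous).subsingleton ⟨s, rfl⟩ ⟨t, rfl⟩
  let pt : TopSimplex 1 := stdSimplex.vertex 0
  let ε : SingChain T 1 →ₗ[ℚ] T →₀ ℚ := Finsupp.lmapDomain ℚ ℚ fun σ => σ pt
  have hε : ∀ c, ε (bd T 1 c) = 0 := fun c => by
    refine LinearMap.congr_fun (f := ε ∘ₗ bd T 1) (g := 0) (hom_ext fun σ => ?_) c
    rw [LinearMap.comp_apply, bd_single, Fin.sum_univ_two]
    have hs : ∀ τ, ε (Finsupp.single τ 1) = Finsupp.single (τ pt) 1 := by simp [ε]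
    simp only [map_add, map_smul, hs, ContinuousMap.comp_apply]
    rw [hconst σ (TopSimplex.face (Fin.succAbove 1) pt) (TopSimplex.face (Fin.succAbove 0) pt)]
    simp
  let ε' : Homology T 0 →ₗ[ℚ] T →₀ ℚ :=
    Submodule.liftQ _ (ε ∘ₗ Submodule.subtype _) fun c ⟨w, hw⟩ => by
      rw [LinearMap.mem_ker, LinearMap.comp_apply, ← hw]
      exact hε w
  have hsurj : Function.Surjective ε' := fun x => by
    refine ⟨homologyClass T 0 ⟨Finsupp.mapDomain (ContinuousMap.const _) x, trivial⟩, ?_⟩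
    change Finsupp.mapDomain _ (Finsupp.mapDomain _ x) = x
    rw [← Finsupp.mapDomain_comp]
    exact Finsupp.mapDomain_id
  calc Cardinal.mk T = Module.rank ℚ (T →₀ ℚ) := by simp
    _ ≤ Module.rank ℚ (Homology T 0) := LinearMap.rank_le_of_surjective ε' hsurj
    _ ≤ totalRank T := Cardinal.le_sum _ 0

/-- The total rank of homology does not increase when a space that is the union of two prisms over
a subspace `Y` and of a cylinder over a subspace of `Y` is replaced by the midsection of the
cylinder. -/
theorem totalRank_slice_le {ι : Type} [DecidableEq ι] (X : Set (ι → ℝ)) (v : ι)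
    (hsides : ∀ x ∈ X, Function.update x v 1 ∈ X ∧ Function.update x v (-1) ∈ X)
    (hcyl : ∀ x ∈ X, -1 < x v → x v < 1 → ∀ t ∈ Set.Icc (-1 : ℝ) 1, Function.update x v t ∈ X) :
    totalRank {x | x ∈ X ∧ x v = 0} ≤ totalRank X := by
  let Z : Set (ι → ℝ) := {x | x ∈ X ∧ x v = 0}
  let Y : Set (ι → ℝ) := {x | x ∈ X ∧ x v = 1}
  let U : Set X := {x | -1 < x.1 v}
  let V : Set X := {x | x.1 v < 1}
  have hev : Continuous fun x : X => x.1 v := (continuous_apply v).comp continuous_subtype_val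
  have hU : IsOpen U := isOpen_lt continuous_const hev
  have hV : IsOpen V := isOpen_lt hev continuous_const
  have hUV : U ∪ V = Set.univ := Set.eq_univ_of_forall fun x => by
    rcases lt_or_ge (x.1 v) 1 with h | h
    exacts [Or.inr h, Or.inl (show -1 < x.1 v by linarith)]
  have hZ : ∀ z : Z, ∀ t ∈ Set.Icc (-1 : ℝ) 1, Function.update z.1 v t ∈ X := fun z t ht =>
    hcyl _ z.2.1 (by rw [z.2.2]; norm_num) (by rw [z.2.2]; norm_num) t ht
  let i : C(Z, ↥(U ∩ V)) := ⟨fun z => ⟨⟨z.1, z.2.1⟩,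
    show -1 < z.1 v by rw [z.2.2]; norm_num, show z.1 v < 1 by rw [z.2.2]; norm_num⟩, by fun_prop⟩
  let q : C(↥(U ∩ V), Z) := ⟨fun x => ⟨Function.update x.1.1 v 0,
    hcyl _ x.1.2 x.2.1 x.2.2 0 (by norm_num), by simp⟩,
    Continuous.subtype_mk (Continuous.update (by fun_prop) v continuous_const) _⟩
  let f : C(Z, Y) := ⟨fun z => ⟨Function.update z.1 v 1, (hsides _ z.2.1).1, by simp⟩,
    Continuous.subtype_mk (Continuous.update (by fun_prop) v continuous_const) _⟩
  let jU : C(Y, U) := ⟨fun y => ⟨⟨y.1, y.2.1⟩, show -1 < y.1 v by rw [y.2.2]; norm_num⟩,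
    by fun_prop⟩
  -- Moving `Y` to the opposite side lets the inclusion of `Z` in `V` factor through the same `f` as
  -- the one in `U`.
  let jV : C(Y, V) := ⟨fun y => ⟨⟨Function.update y.1 v (-1), (hsides _ y.2.1).2⟩,
    show Function.update y.1 v (-1) v < 1 by simp⟩, Continuous.subtype_mk (Continuous.subtype_mk
      (Continuous.update (by fun_prop) v continuous_const) _) _⟩
  let p : C(X, Y) := ⟨fun x => ⟨Function.update x.1 v 1, (hsides _ x.2).1, by simp⟩,
    Continuous.subtype_mk (Continuous.update (by fun_prop) v continuous_const) _⟩
  -- The homotopies slide the midsection along the cylinder: coordinate `v` is `t` in `U` and `-t`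
  -- in `V`.
  refine totalRank_le_of_openCover hU hV hUV i q ?_ f jU jV p ?_ ⟨⟨fun tz =>
      ⟨⟨Function.update tz.2.1 v tz.1, hZ _ _ ⟨by linarith [tz.1.2.1], tz.1.2.2⟩⟩,
        show -1 < Function.update tz.2.1 v (tz.1 : ℝ) v by simp; linarith [tz.1.2.1]⟩, ?_⟩, ?_, ?_⟩
    ⟨⟨fun tz =>
      ⟨⟨Function.update tz.2.1 v (-tz.1),
        hZ _ _ ⟨by linarith [tz.1.2.2], by linarith [tz.1.2.1]⟩⟩,
        show Function.update tz.2.1 v (-tz.1 : ℝ) v < 1 by simp; linarith [tz.1.2.1]⟩, ?_⟩, ?_, ?_⟩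
  · ext z : 2
    exact Function.update_eq_self_iff.2 z.2.2.symm
  · ext y : 2
    exact Function.update_eq_self_iff.2 y.2.2.symm
  · exact Continuous.subtype_mk (Continuous.subtype_mk
      (Continuous.update (by fun_prop) v (by fun_prop)) _) _
  · intro z
    refine Subtype.ext (Subtype.ext ?_)
    exact Function.update_eq_self_iff.2 z.2.2.symm
  · intro z
    rfl
  · exact Continuous.subtype_mk (Continuous.subtype_mk
      (Continuous.update (by fun_prop) v (by fun_prop)) _) _
  · intro z
    refine Subtype.ext (Subtype.ext ?_)
    exact Function.update_eq_self_iff.2 (by simp [z.2.2])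
  · intro z
    refine Subtype.ext (Subtype.ext ?_)
    change Function.update z.1 v (-((1 : unitInterval) : ℝ)) =
      Function.update (Function.update z.1 v 1) v (-1)
    simp

end SingChain

/-! ### Real moment-angle complexes -/

section RealMomentAngle

variable {V : Type} {K : PreAbstractSimplicialComplex V}

theorem mem_realMomentAngleComplex {x : V → ℝ} : x ∈ realMomentAngleComplex K ↔
    ∃ ω, K.IsSimplex ω ∧ (∀ i, x i ∈ Set.Icc (-1) 1) ∧ ∀ i, i ∉ ω → x i ∈ ({-1, 1} : Set ℝ) := by
  simp only [realMomentAngleComplex, kPower, Set.mem_iUnion, exists_prop]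
  rfl

variable (K) in
/-- The points of the real moment-angle complex whose coordinates in `A` vanish. -/
def vanishingSlice (A : Finset V) : Set (V → ℝ) :=
  {x | x ∈ realMomentAngleComplex K ∧ ∀ i ∈ A, x i = 0}

theorem totalRank_vanishingSlice_le [DecidableEq V] (A : Finset V) :
    SingChain.totalRank (vanishingSlice K A) ≤ SingChain.totalRank (realMomentAngleComplex K) := by
  induction A using Finset.induction_on with
  | empty =>
    have : vanishingSlice K ∅ = realMomentAngleComplex K := by ext; simp [vanishingSlice]
    rw [this]
  | insert v A hv ih =>
    have hins : vanishingSlice K (insert v A) = {x | x ∈ vanishingSlice K A ∧ x v = 0} := by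
      ext x
      simp only [vanishingSlice, Finset.forall_mem_insert, Set.mem_ofPred_eq]
      tauto
    -- If `-1 < x v < 1`, then `v` belongs to the simplex carrying `x`, so its coordinate is free;
    -- the values `±1` are always allowed. The carrying simplex is unchanged.
    have hupd : ∀ x ∈ vanishingSlice K A, ∀ t ∈ Set.Icc (-1 : ℝ) 1,
        (-1 < x v ∧ x v < 1 ∨ t ∈ ({-1, 1} : Set ℝ)) →
        Function.update x v t ∈ vanishingSlice K A := by
      rintro x ⟨hx, hxA⟩ t ht h
      obtain ⟨ω, hω, hI, hS⟩ := mem_realMomentAngleComplex.1 hx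
      refine ⟨mem_realMomentAngleComplex.2 ⟨ω, hω, fun i => ?_, fun i hi => ?_⟩, fun i hi => ?_⟩
      · rcases eq_or_ne i v with rfl | hne
        · simpa using ht
        · simpa [hne] using hI i
      · rcases eq_or_ne i v with rfl | hne
        · rw [Function.update_self]
          refine h.resolve_left fun h => ?_
          rcases hS i hi with h' | h' <;> rw [h'] at h
          exacts [lt_irrefl _ h.1, lt_irrefl _ h.2]
        · simpa [hne] using hS i hi
      · have hne : i ≠ v := by
          rintro rfl
          exact hv hi
        simpa [hne] using hxA i hi
    rw [hins]
    refine (SingChain.totalRank_slice_le _ v (fun x hx => ⟨?_, ?_⟩) fun x hx h h' t ht => ?_).trans ih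
    · exact hupd x hx 1 (by norm_num) (by simp)
    · exact hupd x hx (-1) (by norm_num) (by simp)
    · exact hupd x hx t ht (Or.inl ⟨h, h'⟩)

/-- A zero coordinate is not `±1`, so the simplex carrying such a point contains `ω` and, by
maximality, equals it. -/
theorem mem_vanishingSlice_iff_of_maximal {ω : Finset V} (hω : Maximal K.IsSimplex ω) {x : V → ℝ} :
    x ∈ vanishingSlice K ω ↔ (∀ i ∈ ω, x i = 0) ∧ ∀ i, i ∉ ω → x i ∈ ({-1, 1} : Set ℝ) := by
  constructor
  · rintro ⟨hx, h0⟩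
    obtain ⟨σ, hσ, -, hS⟩ := mem_realMomentAngleComplex.1 hx
    have hωσ : ω ≤ σ := fun i hi => by
      by_contra hiσ
      have := hS i hiσ
      rw [h0 i hi] at this
      norm_num at this
    exact ⟨h0, fun i hi => hS i fun hiσ => hi (hω.2 hσ hωσ hiσ)⟩
  · rintro ⟨h0, hS⟩
    refine ⟨mem_realMomentAngleComplex.2 ⟨ω, hω.1, fun i => ?_, hS⟩, h0⟩
    by_cases hi : i ∈ ω
    · rw [h0 i hi]
      norm_num
    · rcases hS i hi with h | h <;> rw [h] <;> norm_num

/-- The total cohomology rank of the real moment-angle complex is at least the number of points with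
vanishing coordinates in a maximal simplex. -/
theorem two_pow_le_hrk_of_maximal [Fintype V] [DecidableEq V] {ω : Finset V}
    (hω : Maximal K.IsSimplex ω) :
    (2 : Cardinal.{0}) ^ (Fintype.card V - ω.card) ≤ hrk (realMomentAngleComplex K) := by
  have hfin : (vanishingSlice K ω).Finite := by
    refine (Set.Finite.pi' (t := fun _ : V => ({0, -1, 1} : Set ℝ)) fun _ => by simp).subset
      fun x hx i => ?_
    rw [mem_vanishingSlice_iff_of_maximal hω] at hx
    by_cases hi : i ∈ ω
    exacts [Or.inl (hx.1 i hi), Or.inr (hx.2 i hi)]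
  -- A finite subspace is discrete, hence totally disconnected, as the bound by `H_0` requires.
  have : Finite (vanishingSlice K ω) := hfin
  let g : ({i // i ∉ ω} → Bool) → vanishingSlice K ω := fun b =>
    ⟨fun i => if hi : i ∈ ω then 0 else if b ⟨i, hi⟩ then 1 else -1,
      (mem_vanishingSlice_iff_of_maximal hω).2 ⟨fun i hi => by simp [hi], fun i hi => by
        cases hb : b ⟨i, hi⟩ <;> simp [hi, hb]⟩⟩
  have hg : Function.Injective g := fun b b' h => by
    funext i
    have := congr(($h).1 i)
    simp only [g, i.2, dite_false] at this
    cases hb : b i <;> cases hb' : b' i <;> simp [hb, hb'] at this ⊢ <;> norm_num at this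
  calc (2 : Cardinal.{0}) ^ (Fintype.card V - ω.card)
      = Cardinal.mk ({i // i ∉ ω} → Bool) := by
        simp [Fintype.card_subtype_compl]
    _ ≤ Cardinal.mk (vanishingSlice K ω) := Cardinal.mk_le_of_injective hg
    _ ≤ SingChain.totalRank (vanishingSlice K ω) := SingChain.mk_le_totalRank _
    _ ≤ SingChain.totalRank (realMomentAngleComplex K) := totalRank_vanishingSlice_le ω
    _ ≤ hrk (realMomentAngleComplex K) := SingChain.totalRank_le_hrk _

end RealMomentAngle

theorem theorem3p2 (m n : ℕ) (K : PreAbstractSimplicialComplex (Fin m))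
    (hK : K.mdim = (n : ℤ) - 1) :
    (2 : Cardinal.{0}) ^ (m - n) ≤ hrk (realMomentAngleComplex K) := by
  -- Every maximal simplex gives a bound; one of least dimension gives the strongest. As `n` becomes
  -- the size of a subset of `Fin m`, the subtraction `m - n` is not truncated.
  obtain ⟨ω, hω, h⟩ := K.isLeast_mdim.1
  obtain rfl : n = ω.card := by omega
  simpa using two_pow_le_hrk_of_maximal hω
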